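/- **Proper buildings.** Let $n\ge 0$. A word is a *proper coloring* if no two consecutive symbols are equal. For $x\in[4]^n$, where $[4]=\{1,2,3,4\}$, and a permutation $\sigma\in S_n$, let $x^\sigma_{(t)}=(x_i:\sigma(i)\le t)$ be the subsequence of symbols that arrived by time $t$, ordered as in $x$. Call $\sigma$ a *proper building* of $x$ if $x^\sigma_{(t)}$ is a proper coloring for each $t=1,\dots,n$. Let $B(x)$ be the number of proper buildings of $x$. **Rows.** Fix any bijection from $[4]$ to $\{-,+\}^2$, where $\pm$ stands for $\pm1$, and use it to write $x=\binom yz$ with rows $y,z\in\{-,+\}^n$. **Permutations with given descents.** For $y\in\{-,+\}^n$ let $\alpha(y)$ be the number of $\pi\in S_{n+1}$ such that, for each $1\le i\le n$, $\pi_i<\pi_{i+1}$ if $y_i=+$ and $\pi_i>\pi_{i+1}$ if $y_i=-$. **Dispersed Dyck words.** A *Dyck word* is a word in $\{-,+\}^{2k}$ with $k$ $+$'s and $k$ $-$'s such that, for each $i$, the $i$th $+$ precedes the $i$th $-$. A *dispersed Dyck word* of length $r$ is an element of $\{-,0,+\}^r$ that is a concatenation of Dyck words and strings of $0$'s. Let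 $D(r)$ be the set of these, and for $w\in D(r)$ let $|w|$ be the number of $+$'s in $w$. **The words $y_w$ and the coefficients $c$.** Let $m$ be the number of runs (maximal intervals of constancy) of $y$, and let $w\in D(m-1)$. - $y_w$ is the word obtained from $y$ by changing the signs of some whole runs of $y$, not including the first and last, in such a way that the $j$th sign-change between runs is eliminated precisely for those $j$ with $w_j\ne0$. - For $1\le j\le m-1$ let $\ell_j$ and $r_j$ be the elements of $z$ immediately before and immediately after the $j$th sign-change in $y$. Then $$c(w,y,z)=\prod_{j=1}^{m-1}\begin{cases}\ell_j,&w_j=+;\\ r_j,&w_j=-;\\ 1,&w_j=0.\end{cases}$$ **The formula.** For $n\ge1$ define $$Q(x)=Q\tbinom yz=\begin{cases}\displaystyle 2^{n-m}\sum_{w\in D(m-1)}(-1)^{|w|}\,c(w,y,z)\,\alpha(y_w)&\text{if $x$ is a proper coloring;}\\ 0&\text{otherwise,}\end{cases}$$ and for the empty word ($n=0$) set $Q(\emptyset)=1$. **Theorem.** For every $n\ge0$ and every $x\in[4]^n$ we have $B(x)=Q(x)$. -/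

import Mathlib

namespace DyckBuildings

/-- A word is a proper coloring if any two consecutive symbols differ. -/
abbrev IsProperColoring {A : Type*} (l : List A) : Prop :=
  l.IsChain (fun a b => a ≠ b)

/-- The subsequence of those symbols of `x` that have arrived by time `t`, in the order in which
they occur in `x`, where the symbol `x i` arrives at time `σ i` (times are `0, …, n - 1`). -/
def arrivedBy {A : Type*} {n : ℕ} (x : Fin n → A) (σ : Equiv.Perm (Fin n)) (t : Fin n) : List A :=
  ((List.finRange n).filter (fun i => σ i ≤ t)).map x

/-- `σ` is a proper building of `x`: at every time, the symbols that have arrived form a proper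
coloring. -/
abbrev IsProperBuilding {A : Type*} {n : ℕ} (x : Fin n → A) (σ : Equiv.Perm (Fin n)) : Prop :=
  ∀ t : Fin n, IsProperColoring (arrivedBy x σ t)

/-- `B(x)`, the number of proper buildings of the word `x`. -/
def buildingCount {A : Type*} [DecidableEq A] {n : ℕ} (x : Fin n → A) : ℕ :=
  (Finset.univ.filter (fun σ : Equiv.Perm (Fin n) => IsProperBuilding x σ)).card

/-- `α(y)`: the number of permutations `π` of `n + 1` elements with an ascent at each `i` such that
`y i = +` and a descent at each `i` such that `y i = -`. -/
def alpha {n : ℕ} (y : Fin n → ℤˣ) : ℕ :=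
  (Finset.univ.filter (fun π : Equiv.Perm (Fin (n + 1)) =>
    ∀ i : Fin n, (y i = 1 → π i.castSucc < π i.succ) ∧
      (y i = -1 → π i.succ < π i.castSucc))).card

/-- A Dyck word written with the letters `+` and `-`. -/
def dyckSigns (d : DyckWord) : List SignType :=
  d.toList.map (fun s => match s with
    | DyckStep.U => 1
    | DyckStep.D => -1)

/-- A dispersed Dyck word: a word over `{-, 0, +}` that is a concatenation of Dyck words and
strings of `0`s. -/
def IsDispersedDyck (w : List SignType) : Prop :=
  ∃ L : List (List SignType), w = L.flatten ∧
    ∀ u ∈ L, (∃ d : DyckWord, u = dyckSigns d) ∨ (∃ k : ℕ, u = List.replicate k 0)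

open Classical in
/-- The finite set of dispersed Dyck words of length `m`. -/
noncomputable def dispersedDyckWords (m : ℕ) : Finset (List SignType) :=
  ((Finset.univ : Finset (Fin m → SignType)).image List.ofFn).filter IsDispersedDyck

theorem mem_dispersedDyckWords {m : ℕ} {w : List SignType} :
    w ∈ dispersedDyckWords m ↔ w.length = m ∧ IsDispersedDyck w := by
  classical
  simp only [dispersedDyckWords, Finset.mem_filter, Finset.mem_image, Finset.mem_univ, true_and]
  constructor
  · rintro ⟨⟨f, rfl⟩, h⟩
    exact ⟨List.length_ofFn, h⟩
  · rintro ⟨rfl, h⟩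
    exact ⟨⟨w.get, List.ofFn_get w⟩, h⟩

/-- The number of runs (maximal intervals of constancy) of `y`: the number of positions at which a
run begins, that is, which have no predecessor carrying the same sign. -/
def numRuns {n : ℕ} (y : Fin n → ℤˣ) : ℕ :=
  (Finset.univ.filter (fun i : Fin n => ∀ k : Fin n, (k : ℕ) + 1 = i → y k ≠ y i)).card

/-- The sign-changes of `y`, each given as the pair of the positions immediately before and
immediately after it. -/
def signChanges {n : ℕ} (y : Fin n → ℤˣ) : Finset (Fin n × Fin n) :=
  Finset.univ.filter (fun p => (p.1 : ℕ) + 1 = p.2 ∧ y p.1 ≠ y p.2)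

/-- The number of sign-changes of `y` preceding position `i`. Counting from `0`, position `i` lies
in the run of this index, and a sign-change `p` is the sign-change of index `runIndex y p.1`. -/
def runIndex {n : ℕ} (y : Fin n → ℤˣ) (i : Fin n) : ℕ :=
  ((signChanges y).filter (fun p => p.1 < i)).card

/-- The word `y_w`, obtained from `y` by changing the signs of whole runs, not including the first,
so that the `j`-th sign-change is eliminated exactly when `w j ≠ 0`. Thus a run is changed
exactly when an odd number of the sign-changes before it are eliminated. (As a dispersed Dyck word
has an even number of nonzero letters, the last run is not changed either.) -/
def flipRuns {n : ℕ} (y : Fin n → ℤˣ) (w : List SignType) : Fin n → ℤˣ :=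
  fun i => (-1) ^ ((w.take (runIndex y i)).countP (fun s => s ≠ 0)) * y i

/-- `c(w, y, z)`: the product over the sign-changes of `y` of the symbol of `z` immediately before
the change if the corresponding letter of `w` is `+`, the symbol of `z` immediately after the
change if that letter is `-`, and `1` if it is `0`. -/
def coeff {n : ℕ} (w : List SignType) (y z : Fin n → ℤˣ) : ℤ :=
  ∏ p ∈ signChanges y,
    match w.getD (runIndex y p.1) 0 with
    | SignType.pos => (z p.1 : ℤ)
    | SignType.neg => (z p.2 : ℤ)
    | SignType.zero => 1

/-- The signed sum `Q` over dispersed Dyck words, for the word with rows `y` and `z`. For the empty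
word the sum is over the single dispersed Dyck word of length `0`, so that `Q = 1`. -/
noncomputable def Q {n : ℕ} (y z : Fin n → ℤˣ) : ℤ :=
  if IsProperColoring (List.ofFn (fun i => (y i, z i))) then
    2 ^ (n - numRuns y) *
      ∑ w ∈ dispersedDyckWords (numRuns y - 1),
        (-1) ^ (w.count 1) * coeff w y z * (alpha (flipRuns y w) : ℤ)
  else 0

end DyckBuildings

namespace DyckBuildings

/-! Deleting the last arrival shows that `B(x)` is the sum of `B` over all deletions of one letter
of `x` if `x` is proper, and `0` otherwise. It suffices that `Q` obeys this recurrence and that both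
equal `1` at the empty word.

Reading a dispersed Dyck word as a height path turns `Q` into a product of transfer operators `T =
step`, one for each pair of adjacent letters: a sign-change of the first row goes up with weight
`-ℓ`, down with weight `r`, or stays at height 0 with weight 1. A pair without sign-change stays
with weight `1 - ℓ r`, which is 2 in a proper word and 0 at a repeated letter. The signs at odd
heights are flipped, and `α` is applied to the resulting word (`Q_eq_wordSum`).

With `D = stepDown` and `U = stepUp`, deletion of an interior letter `x'` obeys `2 T(x,x'') =
D(x,x') T(x',x'') + T(x,x') U(x',x'')` (`two_mul_step`). Summed over all letters and regrouped by
adjacent pairs, each pair receives `D + U`, in which the up and down steps cancel. What survives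
deletes one of the two letters at a sign-change of the flipped word, or an end letter
(`two_mul_sum_wordSum_eraseIdx`). By `two_mul_alpha` these deletions of `y_w` add up to `2 α(y_w)`.
-/

/-! ### Local identities between the transfer operators -/

/-- One step of the transfer operator on height functions. -/
def step (x x' : ℤˣ × ℤˣ) (h : ℕ) (f : ℕ → ℤ) : ℤ :=
  if x.1 = x'.1 then (1 - x.2 * x'.2) * f h
  else (if h = 0 then f 0 else x'.2 * f (h - 1)) - x.2 * f (h + 1)

/-- The variant of `step` in which steps without sign-change are dropped and down-steps change
sign. -/
def stepDown (x x' : ℤˣ × ℤˣ) (h : ℕ) (f : ℕ → ℤ) : ℤ :=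
  if x.1 = x'.1 then 0
  else (if h = 0 then f 0 else -(x'.2 * f (h - 1))) - x.2 * f (h + 1)

/-- The variant of `step` in which steps without sign-change are dropped and up-steps change
sign. -/
def stepUp (x x' : ℤˣ × ℤˣ) (h : ℕ) (f : ℕ → ℤ) : ℤ :=
  if x.1 = x'.1 then 0
  else (if h = 0 then f 0 else x'.2 * f (h - 1)) + x.2 * f (h + 1)

theorem units_eq_or_of_ne {a b c : ℤˣ} (h : a ≠ b) (h' : b ≠ c) : a = c := by
  rcases Int.units_eq_one_or a with rfl | rfl <;> rcases Int.units_eq_one_or b with rfl | rfl <;>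
    rcases Int.units_eq_one_or c with rfl | rfl <;> simp_all

/-- With one sign-change, one product vanishes and the other has the factor 2, the reversed sign in
`stepDown` or `stepUp` making up for the opposite second-row signs of the two letters with equal
first sign. With two sign-changes, the products that change the height cancel, and the round trips
(or two stays at height 0) give `2 (1 - x.2 * x''.2)`. Nothing forces `x ≠ x''`; if they agree, both
sides vanish. -/
theorem two_mul_step {x x' x'' : ℤˣ × ℤˣ} (h₁ : x ≠ x') (h₂ : x' ≠ x'') (h : ℕ) (f : ℕ → ℤ) :
    2 * step x x'' h f = stepDown x x' h (fun k => step x' x'' k f) +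
      step x x' h (fun k => stepUp x' x'' k f) := by
  obtain ⟨a, b⟩ := x
  obtain ⟨a', b'⟩ := x'
  obtain ⟨a'', b''⟩ := x''
  simp only [ne_eq, Prod.mk.injEq, not_and] at h₁ h₂
  have sq : (b' : ℤ) * b' = 1 := by
    rcases Int.units_eq_one_or b' with rfl | rfl <;> rfl
  by_cases e₁ : a = a' <;> by_cases e₂ : a' = a''
  · subst e₁ e₂
    have hb := units_eq_or_of_ne (h₁ rfl) (h₂ rfl)
    subst hb
    rcases Int.units_eq_one_or b with rfl | rfl <;> simp [step, stepDown, stepUp]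
  · subst e₁
    have hb := Int.units_ne_iff_eq_neg.mp (h₁ rfl)
    subst hb
    rcases h with _ | _ | h <;> simp [step, stepDown, stepUp, e₂]
  · subst e₂
    have hb := Int.units_ne_iff_eq_neg.mp (h₂ rfl)
    subst hb
    rcases h with _ | _ | h <;> simp [step, stepDown, stepUp, e₁] <;> grind
  · have := units_eq_or_of_ne e₁ e₂
    subst this
    rcases h with _ | _ | h <;> simp [step, stepDown, stepUp, e₁, e₂] <;> grind

/-- The counterpart of `two_mul_step` for deletion of the first letter, where paths are at height 0.
-/
theorem step_add_stepUp_zero {x x' : ℤˣ × ℤˣ} (hx : x ≠ x') (f : ℕ → ℤ) :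
    step x x' 0 f + stepUp x x' 0 f = 2 * f 0 := by
  obtain ⟨a, b⟩ := x
  obtain ⟨a', b'⟩ := x'
  simp only [ne_eq, Prod.mk.injEq, not_and] at hx
  by_cases e : a = a'
  · subst e
    have hb := Int.units_ne_iff_eq_neg.mp (hx rfl)
    subst hb
    rcases Int.units_eq_one_or b' with rfl | rfl <;> simp [step, stepUp]
  · simp [step, stepUp, e]
    ring

/-- The counterpart of `two_mul_step` for deletion of the last letter: paths must end at height 0,
so `f` is supported there. -/
theorem stepDown_add_step_zero {x x' : ℤˣ × ℤˣ} (hx : x ≠ x') (h : ℕ) (f : ℕ → ℤ) (c : ℤ)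
    (hf : ∀ k, f k = if k = 0 then c else 0) :
    stepDown x x' h f + step x x' h f = 2 * if h = 0 then c else 0 := by
  obtain ⟨a, b⟩ := x
  obtain ⟨a', b'⟩ := x'
  simp only [ne_eq, Prod.mk.injEq, not_and] at hx
  by_cases e : a = a'
  · subst e
    have hb := Int.units_ne_iff_eq_neg.mp (hx rfl)
    subst hb
    rcases Int.units_eq_one_or b' with rfl | rfl <;> simp [step, stepDown, hf]
  · rcases h with _ | h <;> simp [step, stepDown, hf, e]
    ring

theorem step_add (x x' : ℤˣ × ℤˣ) (h : ℕ) (f g : ℕ → ℤ) :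
    step x x' h (fun k => f k + g k) = step x x' h f + step x x' h g := by
  unfold step
  split_ifs <;> ring

theorem step_const_mul (x x' : ℤˣ × ℤˣ) (h : ℕ) (c : ℤ) (f : ℕ → ℤ) :
    step x x' h (fun k => c * f k) = c * step x x' h f := by
  unfold step
  split_ifs <;> ring

theorem step_sum {ι : Type*} (s : Finset ι) (x x' : ℤˣ × ℤˣ) (h : ℕ) (f : ι → ℕ → ℤ) :
    step x x' h (fun k => ∑ i ∈ s, f i k) = ∑ i ∈ s, step x x' h (f i) := by
  classical
  induction s using Finset.induction_on with
  | empty => simp [step]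
  | insert a s ha ih => simp only [Finset.sum_insert ha, step_add, ih]

/-! ### Path sums and the deletion of letters -/

/-- The sum over all height paths that start at `h` and end at `0` along the word `x :: l`, of the
product of the weights of the steps and the value of `φ` at the word of signs that arises from the
first row by changing the signs at odd heights. -/
def pathSum : List (ℤˣ × ℤˣ) → (List ℤˣ → ℤ) → ℕ → ℤˣ × ℤˣ → ℤ
  | [], φ, h, x => if h = 0 then φ [x.1] else 0
  | x' :: l, φ, h, x => step x x' h (fun k => pathSum l (fun u => φ ((-1) ^ h * x.1 :: u)) k x')

/-- `φ` is only evaluated at words with this first letter, so conditions on the head of the word can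
be decided outside the sum. -/
theorem pathSum_congr {l : List (ℤˣ × ℤˣ)} {φ ψ : List ℤˣ → ℤ} {h : ℕ} {x : ℤˣ × ℤˣ}
    (H : ∀ u, φ ((-1) ^ h * x.1 :: u) = ψ ((-1) ^ h * x.1 :: u)) :
    pathSum l φ h x = pathSum l ψ h x := by
  cases l with
  | nil =>
    rcases Nat.eq_zero_or_pos h with rfl | hh
    · simpa [pathSum] using H []
    · simp [pathSum, hh.ne']
  | cons x' l => simp only [pathSum, H]

theorem pathSum_add (l : List (ℤˣ × ℤˣ)) (φ ψ : List ℤˣ → ℤ) (h : ℕ) (x : ℤˣ × ℤˣ) :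
    pathSum l (fun u => φ u + ψ u) h x = pathSum l φ h x + pathSum l ψ h x := by
  induction l generalizing φ ψ h x with
  | nil => unfold pathSum; split_ifs <;> simp
  | cons x' l ih => simp only [pathSum, ih, step_add]

theorem pathSum_const_mul (l : List (ℤˣ × ℤˣ)) (c : ℤ) (φ : List ℤˣ → ℤ) (h : ℕ) (x : ℤˣ × ℤˣ) :
    pathSum l (fun u => c * φ u) h x = c * pathSum l φ h x := by
  induction l generalizing φ h x with
  | nil => unfold pathSum; split_ifs <;> simp
  | cons x' l ih => simp only [pathSum, ih, step_const_mul]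

/-- The sum over all height paths along `x :: l`, where the sign of `x` is dropped and the first
step is taken with `stepUp`. -/
def tailPathSum : List (ℤˣ × ℤˣ) → (List ℤˣ → ℤ) → ℕ → ℤˣ × ℤˣ → ℤ
  | [], φ, h, _ => if h = 0 then φ [] else 0
  | x' :: l, φ, h, x => stepUp x x' h (fun k => pathSum l φ k x')

/-- The sum of the values of `φ` at the words obtained by deleting one of the two letters at a
sign-change, or the last letter. -/
def changeSum : (List ℤˣ → ℤ) → List ℤˣ → ℤ
  | _, [] => 0
  | φ, [_] => φ []
  | φ, a :: b :: u =>
    (if a = b then 0 else φ (b :: u) + φ (a :: u)) + changeSum (fun v => φ (a :: v)) (b :: u)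

theorem two_mul_pathSum {x x' : ℤˣ × ℤˣ} {l : List (ℤˣ × ℤˣ)}
    (hl : IsProperColoring (x :: x' :: l)) (φ : List ℤˣ → ℤ) (h : ℕ) :
    2 * pathSum l φ h x =
      stepDown x x' h (fun k => pathSum l (fun u => φ ((-1) ^ h * x.1 :: u.tail)) k x') +
      step x x' h (fun k => tailPathSum l (fun u => φ ((-1) ^ h * x.1 :: u)) k x') := by
  cases l with
  | nil =>
    simp only [IsProperColoring, List.isChain_cons_cons] at hl
    have := stepDown_add_step_zero hl.1 h
      (fun k => if k = 0 then φ [(-1) ^ h * x.1] else 0) _ (fun _ => rfl)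
    simp only [pathSum, tailPathSum, List.tail_cons, this]
    rcases Nat.eq_zero_or_pos h with rfl | hh
    · simp
    · simp [hh.ne']
  | cons x'' l =>
    simp only [IsProperColoring, List.isChain_cons_cons] at hl
    simpa [pathSum, tailPathSum] using two_mul_step hl.1 hl.2.1 h _

/-- The contribution of one pair: the `stepDown` term stems from deleting `x'`, the `stepUp` term
from deleting `x`. A step up or down at a sign-change makes the two flipped letters equal, so both
deletions give the same word and the opposite weights cancel. Only the stay at height 0 keeps the
letters different, and there both deletions count. -/
theorem stepDown_add_stepUp {x x' : ℤˣ × ℤˣ} (l : List (ℤˣ × ℤˣ)) (φ : List ℤˣ → ℤ) (h : ℕ) :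
    stepDown x x' h (fun k => pathSum l (fun u => φ ((-1) ^ h * x.1 :: u.tail)) k x') +
      stepUp x x' h (fun k => pathSum l φ k x') =
    step x x' h (fun k => pathSum l (fun u => if some ((-1) ^ h * x.1) = u.head? then 0 else
      φ u + φ ((-1) ^ h * x.1 :: u.tail)) k x') := by
  obtain ⟨a, b⟩ := x
  obtain ⟨a', b'⟩ := x'
  have hzero : ∀ k (c : ℤˣ), c = (-1) ^ k * a' →
      pathSum l (fun u => if some c = u.head? then 0 else φ u + φ (c :: u.tail)) k (a', b') =
        0 := by
    rintro k c rfl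
    rw [pathSum_congr (ψ := fun u => 0 * φ u) (by simp), pathSum_const_mul, zero_mul]
  have heq : ∀ k (c : ℤˣ), c = (-1) ^ k * a' →
      pathSum l (fun u => φ (c :: u.tail)) k (a', b') = pathSum l φ k (a', b') := by
    rintro k c rfl
    exact pathSum_congr (by simp)
  by_cases e : a = a'
  · subst e
    simp [step, stepDown, stepUp, hzero]
  · have e' := Int.units_ne_iff_eq_neg.mp e
    -- The sign-change and the change of parity of the height compensate each other.
    have hup : (-1 : ℤˣ) ^ h * a = (-1) ^ (h + 1) * a' := by rw [e', pow_succ]; simp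
    simp only [step, stepDown, stepUp, if_neg e, hzero _ _ hup, heq _ _ hup]
    rcases h with _ | h
    · have : pathSum l (fun u => if some ((-1) ^ 0 * a) = u.head? then 0 else
          φ u + φ ((-1) ^ 0 * a :: u.tail)) 0 (a', b') =
          pathSum l φ 0 (a', b') + pathSum l (fun u => φ ((-1) ^ 0 * a :: u.tail)) 0 (a', b') := by
        rw [← pathSum_add]
        exact pathSum_congr (by simp [e])
      simp only [if_true, this]
      ring
    · have hdown : (-1 : ℤˣ) ^ (h + 1) * a = (-1) ^ h * a' := by rw [e', pow_succ]; simp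
      simp only [Nat.add_one_ne_zero, if_false, Nat.add_sub_cancel, hzero _ _ hdown,
        heq _ _ hdown]
      ring

/-- The regrouping by pairs, by induction from the left. `tailPathSum` is the `stepUp` half that
deletion of `x` would contribute to the first pair; with it, that pair is complete and
`stepDown_add_stepUp` applies. -/
theorem sum_pathSum_eraseIdx {x : ℤˣ × ℤˣ} {l : List (ℤˣ × ℤˣ)}
    (hl : IsProperColoring (x :: l)) (φ : List ℤˣ → ℤ) (h : ℕ) :
    2 * ∑ i ∈ Finset.range l.length, pathSum (l.eraseIdx i) φ h x + tailPathSum l φ h x =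
      pathSum l (changeSum φ) h x := by
  induction l generalizing φ h x with
  | nil => simp [tailPathSum, pathSum, changeSum]
  | cons x' l ih =>
    have hl' : IsProperColoring (x' :: l) := by
      simp only [IsProperColoring, List.isChain_cons_cons] at hl ⊢
      exact hl.2
    have key : ∀ k, 2 * ∑ i ∈ Finset.range l.length,
        pathSum (l.eraseIdx i) (fun u => φ ((-1) ^ h * x.1 :: u)) k x' +
        tailPathSum l (fun u => φ ((-1) ^ h * x.1 :: u)) k x' =
        pathSum l (changeSum fun u => φ ((-1) ^ h * x.1 :: u)) k x' := fun k => ih hl' _ _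
    have hright : pathSum (x' :: l) (changeSum φ) h x =
        step x x' h (fun k => pathSum l (fun u => if some ((-1) ^ h * x.1) = u.head? then 0 else
          φ u + φ ((-1) ^ h * x.1 :: u.tail)) k x') +
        step x x' h (fun k => pathSum l (changeSum fun u => φ ((-1) ^ h * x.1 :: u)) k x') := by
      rw [← step_add, pathSum]
      congr 1
      funext k
      rw [← pathSum_add]
      exact pathSum_congr (by simp [changeSum])
    rw [hright, ← stepDown_add_stepUp, List.length_cons, Finset.sum_range_succ', mul_add]
    simp only [List.eraseIdx_cons_succ, List.eraseIdx_cons_zero, pathSum, ← step_sum]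
    rw [two_mul_pathSum hl, ← step_const_mul]
    simp only [← key, step_add, tailPathSum]
    ring

/-- The sum over all height paths from `0` to `0` along a word. -/
def wordSum (φ : List ℤˣ → ℤ) : List (ℤˣ × ℤˣ) → ℤ
  | [] => φ []
  | x :: l => pathSum l φ 0 x

theorem two_mul_sum_wordSum_eraseIdx {x : ℤˣ × ℤˣ} {l : List (ℤˣ × ℤˣ)}
    (hl : IsProperColoring (x :: l)) (φ : List ℤˣ → ℤ) :
    2 * ∑ i ∈ Finset.range (l.length + 1), wordSum φ ((x :: l).eraseIdx i) =
      wordSum (fun u => φ u.tail + changeSum φ u) (x :: l) := by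
  rw [Finset.sum_range_succ']
  have hcons : ∀ (ψ : List ℤˣ → ℤ) (l' : List (ℤˣ × ℤˣ)),
      wordSum ψ (x :: l') = pathSum l' ψ 0 x := fun _ _ => rfl
  simp only [List.eraseIdx_cons_succ, List.eraseIdx_cons_zero, hcons]
  rw [pathSum_add, ← sum_pathSum_eraseIdx hl]
  have : 2 * wordSum φ l = pathSum l (fun u => φ u.tail) 0 x + tailPathSum l φ 0 x := by
    cases l with
    | nil => simp [wordSum, pathSum, tailPathSum]; ring
    | cons x' l =>
      simp only [IsProperColoring, List.isChain_cons_cons] at hl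
      simp only [wordSum, pathSum, tailPathSum, List.tail_cons]
      exact (step_add_stepUp_zero hl.1 (fun k => pathSum l φ k x')).symm
  rw [mul_add, this]
  ring

/-- A repeated letter carries the weight `1 - x.2 * x.2 = 0`. -/
theorem wordSum_eq_zero {l : List (ℤˣ × ℤˣ)} (hl : ¬ IsProperColoring l) (φ : List ℤˣ → ℤ) :
    wordSum φ l = 0 := by
  have key : ∀ (l : List (ℤˣ × ℤˣ)) (φ : List ℤˣ → ℤ) (h : ℕ) (x : ℤˣ × ℤˣ),
      ¬ IsProperColoring (x :: l) → pathSum l φ h x = 0 := by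
    intro l
    induction l with
    | nil => simp [IsProperColoring]
    | cons x' l ih =>
      intro φ h x hl
      simp only [IsProperColoring, List.isChain_cons_cons, not_and_or, not_not] at hl
      rcases hl with rfl | hl
      · rcases Int.units_eq_one_or x.2 with hx | hx <;> simp [pathSum, step, hx]
      · simp [pathSum, step, ih _ _ _ hl]
  cases l with
  | nil => simp [IsProperColoring] at hl
  | cons x l => exact key l φ 0 x hl

/-! ### Insertion of a largest value, and the recurrence for buildings -/

/-- The permutation of `n + 1` elements with largest value at `i` that arises from the permutation
`τ` of `n` elements. -/
def insertPerm {n : ℕ} (i : Fin (n + 1)) (τ : Equiv.Perm (Fin n)) : Equiv.Perm (Fin (n + 1)) :=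
  (finSuccEquiv' i).trans ((Equiv.optionCongr τ).trans finSuccEquivLast.symm)

@[simp]
theorem insertPerm_apply_self {n : ℕ} (i : Fin (n + 1)) (τ : Equiv.Perm (Fin n)) :
    insertPerm i τ i = Fin.last n := by
  simp [insertPerm]

@[simp]
theorem insertPerm_apply_succAbove {n : ℕ} (i : Fin (n + 1)) (τ : Equiv.Perm (Fin n))
    (k : Fin n) : insertPerm i τ (i.succAbove k) = (τ k).castSucc := by
  simp [insertPerm]

theorem insertPerm_bijective (n : ℕ) :
    Function.Bijective (fun p : Fin (n + 1) × Equiv.Perm (Fin n) => insertPerm p.1 p.2) := by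
  rw [Fintype.bijective_iff_injective_and_card]
  constructor
  · rintro ⟨i, τ⟩ ⟨i', τ'⟩ h
    have h : insertPerm i τ = insertPerm i' τ' := h
    have hi : i = i' := by
      apply (insertPerm i' τ').injective
      rw [insertPerm_apply_self, ← h, insertPerm_apply_self]
    subst hi
    simp only [Prod.mk.injEq, true_and]
    ext k
    have := congrArg (fun σ : Equiv.Perm (Fin (n + 1)) => σ (i.succAbove k)) h
    simp only [insertPerm_apply_succAbove, Fin.castSucc_inj] at this
    rw [this]
  · simp [Fintype.card_perm, Nat.factorial_succ]

theorem card_filter_perm_succ {n : ℕ} (p : Equiv.Perm (Fin (n + 1)) → Prop) [DecidablePred p] :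
    (Finset.univ.filter p).card =
      ∑ i, (Finset.univ.filter fun τ : Equiv.Perm (Fin n) => p (insertPerm i τ)).card := by
  simp only [Finset.card_filter]
  rw [← (insertPerm_bijective n).sum_comp (fun σ => if p σ then 1 else 0), Fintype.sum_prod_type]

theorem arrivedBy_last {A : Type*} {n : ℕ} (x : Fin (n + 1) → A)
    (σ : Equiv.Perm (Fin (n + 1))) : arrivedBy x σ (Fin.last n) = List.ofFn x := by
  rw [arrivedBy, List.ofFn_eq_map, List.filter_eq_self.mpr]
  simp [Fin.le_last]

theorem arrivedBy_insertPerm {A : Type*} {n : ℕ} (x : Fin (n + 1) → A) (i : Fin (n + 1))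
    (τ : Equiv.Perm (Fin n)) (t : Fin n) :
    arrivedBy x (insertPerm i τ) t.castSucc = arrivedBy (fun k => x (i.succAbove k)) τ t := by
  have : (List.finRange (n + 1)).filter (fun k => insertPerm i τ k ≤ t.castSucc) =
      ((List.finRange n).filter (fun k => τ k ≤ t)).map i.succAbove := by
    apply List.SortedLT.eq_of_mem_iff
    · exact ((List.sortedLT_finRange _).pairwise.filter _).sortedLT
    · exact ((((List.sortedLT_finRange _).pairwise.filter _).map _)
        fun a b h => Fin.succAbove_lt_succAbove_iff.mpr h).sortedLT
    · intro k
      rcases Fin.eq_self_or_eq_succAbove i k with rfl | ⟨k, rfl⟩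
      · simp [Fin.succAbove_ne, Fin.last_le_iff, Fin.castSucc_ne_last]
      · simp
  rw [arrivedBy, this, arrivedBy, List.map_map]
  rfl

/-- At the last time the whole word is present; at earlier times the letter at `i` is missing and
the building is that of the shortened word. -/
theorem isProperBuilding_insertPerm {A : Type*} {n : ℕ} (x : Fin (n + 1) → A) (i : Fin (n + 1))
    (τ : Equiv.Perm (Fin n)) :
    IsProperBuilding x (insertPerm i τ) ↔
      IsProperColoring (List.ofFn x) ∧ IsProperBuilding (fun k => x (i.succAbove k)) τ := by
  unfold IsProperBuilding
  rw [Fin.forall_fin_succ']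
  simp only [arrivedBy_insertPerm, arrivedBy_last]
  exact and_comm

theorem buildingCount_succ {A : Type*} [DecidableEq A] {n : ℕ} (x : Fin (n + 1) → A) :
    buildingCount x = if IsProperColoring (List.ofFn x) then
      ∑ i : Fin (n + 1), buildingCount (fun k => x (i.succAbove k)) else 0 := by
  rw [buildingCount, card_filter_perm_succ]
  simp only [isProperBuilding_insertPerm]
  by_cases h : IsProperColoring (List.ofFn x)
  · simp only [h, true_and, if_true, buildingCount]
  · simp only [h, false_and, if_false, Finset.filter_false, Finset.card_empty, Finset.sum_const_zero]

theorem ofFn_comp_succAbove {A : Type*} {n : ℕ} (x : Fin (n + 1) → A) (i : Fin (n + 1)) :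
    List.ofFn (fun k => x (i.succAbove k)) = (List.ofFn x).eraseIdx i := by
  apply List.ext_getElem
  · simp [List.length_eraseIdx, Nat.lt_succ_iff.mp i.2]
  · intro k h₁ h₂
    simp only [List.getElem_ofFn, List.getElem_eraseIdx, Fin.succAbove, Fin.lt_def]
    split_ifs <;> first | rfl | (exfalso; simp_all)

/-! ### The recurrence for permutations with given descents -/

/-- The permutation `π` has an ascent, resp. descent, at `g` if the sign `s` is `1`, resp. `-1`. -/
abbrev HasSign {n : ℕ} (π : Equiv.Perm (Fin (n + 1))) (g : Fin n) (s : ℤˣ) : Prop :=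
  (s = 1 → π g.castSucc < π g.succ) ∧ (s = -1 → π g.succ < π g.castSucc)

/-- Reversing the order of the values exchanges ascents and descents. -/
theorem alpha_neg {n : ℕ} (y : Fin n → ℤˣ) : alpha (fun i => -y i) = alpha y := by
  refine Finset.card_bij' (fun π _ => π.trans Fin.revPerm) (fun π _ => π.trans Fin.revPerm)
    ?_ ?_ ?_ ?_
  · simp only [Finset.mem_filter, Finset.mem_univ, true_and]
    intro π h i
    have := h i
    simp only [neg_eq_iff_eq_neg] at this
    simpa using this.symm
  · simp only [Finset.mem_filter, Finset.mem_univ, true_and]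
    intro π h i
    have := h i
    simp only [neg_eq_iff_eq_neg] 
    simpa using this.symm
  · intro π _; ext; simp
  · intro π _; ext; simp

theorem insertPerm_lt_insertPerm_self {n : ℕ} {i k : Fin (n + 1)} (hk : k ≠ i)
    (τ : Equiv.Perm (Fin n)) : insertPerm i τ k < insertPerm i τ i := by
  rw [insertPerm_apply_self]
  refine Fin.lt_last_iff_ne_last.mpr fun h => hk ((insertPerm i τ).injective ?_)
  rw [h, insertPerm_apply_self]

theorem hasSign_iff_of_lt {n : ℕ} {π : Equiv.Perm (Fin (n + 1))} {g : Fin n}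
    (h : π g.castSucc < π g.succ) (s : ℤˣ) : HasSign π g s ↔ s = 1 := by
  rcases Int.units_eq_one_or s with rfl | rfl <;> simp [HasSign, h, h.le]

theorem hasSign_iff_of_gt {n : ℕ} {π : Equiv.Perm (Fin (n + 1))} {g : Fin n}
    (h : π g.succ < π g.castSucc) (s : ℤˣ) : HasSign π g s ↔ s = -1 := by
  rcases Int.units_eq_one_or s with rfl | rfl <;> simp [HasSign, h, h.le]

theorem hasSign_insertPerm_zero {n : ℕ} (τ : Equiv.Perm (Fin (n + 1))) (y : Fin (n + 1) → ℤˣ) :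
    (∀ g, HasSign (insertPerm 0 τ) g (y g)) ↔
      y 0 = -1 ∧ ∀ g : Fin n, HasSign τ g (y g.succ) := by
  have h1 : ∀ k : Fin (n + 1), insertPerm 0 τ k.succ = (τ k).castSucc := fun k => by
    simpa using insertPerm_apply_succAbove 0 τ k
  rw [Fin.forall_fin_succ]
  refine and_congr ?_ (forall_congr' fun g => ?_)
  · exact hasSign_iff_of_gt (insertPerm_lt_insertPerm_self (Fin.succ_ne_zero _) τ) _
  · simp only [HasSign, h1, ← Fin.succ_castSucc, Fin.castSucc_lt_castSucc_iff]

theorem hasSign_insertPerm_last {n : ℕ} (τ : Equiv.Perm (Fin (n + 1))) (y : Fin (n + 1) → ℤˣ) :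
    (∀ g, HasSign (insertPerm (Fin.last _) τ) g (y g)) ↔
      y (Fin.last n) = 1 ∧ ∀ g : Fin n, HasSign τ g (y g.castSucc) := by
  have h1 : ∀ k : Fin (n + 1), insertPerm (Fin.last _) τ k.castSucc = (τ k).castSucc := fun k => by
    simpa using insertPerm_apply_succAbove (Fin.last _) τ k
  rw [Fin.forall_fin_succ', and_comm]
  refine and_congr ?_ (forall_congr' fun g => ?_)
  · exact hasSign_iff_of_lt (insertPerm_lt_insertPerm_self (Fin.castSucc_ne_last _) τ) _
  · simp only [HasSign, h1, Fin.succ_castSucc, Fin.castSucc_lt_castSucc_iff]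

/-- An interior maximum is a peak. Its removal makes its two neighbours adjacent, at index `j` of
`τ`, where no condition remains. -/
theorem hasSign_insertPerm_middle {n : ℕ} (j : Fin n) (τ : Equiv.Perm (Fin (n + 1)))
    (y : Fin (n + 1) → ℤˣ) :
    (∀ g, HasSign (insertPerm j.succ.castSucc τ) g (y g)) ↔
      (y j.castSucc = 1 ∧ y j.succ = -1) ∧
        ∀ g, g ≠ j → HasSign τ g (y (j.castSucc.succAbove g)) := by
  have hlt : ∀ k : Fin (n + 1), k ≤ j.castSucc →
      insertPerm j.succ.castSucc τ k.castSucc = (τ k).castSucc := fun k hk => by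
    rw [← insertPerm_apply_succAbove j.succ.castSucc, Fin.succAbove_of_castSucc_lt]
    simp only [Fin.lt_def, Fin.le_def, Fin.val_castSucc, Fin.val_succ] at *
    omega
  have hgt : ∀ k : Fin (n + 1), j.castSucc < k →
      insertPerm j.succ.castSucc τ k.succ = (τ k).castSucc := fun k hk => by
    rw [← insertPerm_apply_succAbove j.succ.castSucc, Fin.succAbove_of_le_castSucc]
    simp only [Fin.lt_def, Fin.le_def, Fin.val_castSucc, Fin.val_succ] at *
    omega
  have hj : HasSign (insertPerm j.succ.castSucc τ) j.castSucc (y j.castSucc) ↔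
      y j.castSucc = 1 := by
    refine hasSign_iff_of_lt ?_ _
    rw [Fin.succ_castSucc]
    refine insertPerm_lt_insertPerm_self ?_ τ
    simp [Fin.ext_iff]
  have hj' : HasSign (insertPerm j.succ.castSucc τ) j.succ (y j.succ) ↔ y j.succ = -1 := by
    refine hasSign_iff_of_gt (insertPerm_lt_insertPerm_self ?_ τ) _
    simp [Fin.ext_iff]
  have hbelow : ∀ g : Fin n, g < j →
      (HasSign (insertPerm j.succ.castSucc τ) g.castSucc (y g.castSucc) ↔
        HasSign τ g (y (j.castSucc.succAbove g))) := by
    intro g hg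
    have h1 := hlt g.castSucc (Fin.castSucc_le_castSucc_iff.mpr hg.le)
    have h2 := hlt g.succ (by rw [Fin.le_def]; simpa using hg)
    rw [Fin.succAbove_of_castSucc_lt _ _ (Fin.castSucc_lt_castSucc_iff.mpr hg)]
    simp only [HasSign, Fin.succ_castSucc, h1, h2, Fin.castSucc_lt_castSucc_iff]
  have habove : ∀ g : Fin n, j < g →
      (HasSign (insertPerm j.succ.castSucc τ) g.succ (y g.succ) ↔
        HasSign τ g (y (j.castSucc.succAbove g))) := by
    intro g hg
    have h1 := hgt g.castSucc (Fin.castSucc_lt_castSucc_iff.mpr hg)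
    have h2 := hgt g.succ (by rw [Fin.lt_def] at *; simp; omega)
    rw [Fin.succAbove_of_le_castSucc _ _ (Fin.castSucc_le_castSucc_iff.mpr hg.le)]
    rw [Fin.succ_castSucc] at h1
    rw [HasSign, h1, h2]
    simp only [Fin.castSucc_lt_castSucc_iff]
  constructor
  · refine fun h => ⟨⟨hj.mp (h _), hj'.mp (h _)⟩, fun g hg => ?_⟩
    rcases lt_or_gt_of_ne hg with hg | hg
    · exact (hbelow g hg).mp (h _)
    · exact (habove g hg).mp (h _)
  · rintro ⟨⟨h1, h2⟩, h⟩ g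
    rcases lt_trichotomy g j.castSucc with hg | rfl | hg
    · obtain ⟨g, rfl⟩ := Fin.exists_castSucc_eq.mpr (hg.trans_le (Fin.le_last _)).ne
      have hg := Fin.castSucc_lt_castSucc_iff.mp hg
      exact (hbelow g hg).mpr (h g hg.ne)
    · exact hj.mpr h1
    · obtain ⟨g, rfl⟩ := Fin.exists_succ_eq.mpr (Fin.ne_zero_of_lt hg)
      rcases eq_or_ne g j with rfl | hne
      · exact hj'.mpr h2
      · refine (habove g (lt_of_le_of_ne ?_ hne.symm)).mpr (h g hne)
        exact Nat.lt_succ_iff.mp (Fin.lt_def.mp hg)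

/-- The permutations are split by whether they descend or ascend at the free index `j`. -/
theorem card_hasSign_ne {n : ℕ} (j : Fin n) {y : Fin (n + 1) → ℤˣ} (h₁ : y j.castSucc = 1)
    (h₂ : y j.succ = -1) :
    (Finset.univ.filter fun τ : Equiv.Perm (Fin (n + 1)) =>
      ∀ g, g ≠ j → HasSign τ g (y (j.castSucc.succAbove g))).card =
      alpha (fun g => y (j.castSucc.succAbove g)) + alpha (fun g => y (j.succ.succAbove g)) := by
  have hne : ∀ g, g ≠ j → j.succ.succAbove g = j.castSucc.succAbove g := by
    intro g hg
    simp only [Fin.succAbove, Fin.lt_def, Fin.val_castSucc, Fin.val_succ]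
    have : (g : ℕ) ≠ j := fun h => hg (Fin.ext h)
    split_ifs <;> first | rfl | omega
  have split : ∀ (s : Fin n → Fin (n + 1)), (∀ g, g ≠ j → s g = j.castSucc.succAbove g) →
      ∀ τ : Equiv.Perm (Fin (n + 1)), (∀ g, HasSign τ g (y (s g))) ↔
        (∀ g, g ≠ j → HasSign τ g (y (j.castSucc.succAbove g))) ∧ HasSign τ j (y (s j)) := by
    intro s hs τ
    constructor
    · exact fun h => ⟨fun g hg => hs g hg ▸ h g, h j⟩
    · rintro ⟨h, h'⟩ g
      rcases eq_or_ne g j with rfl | hg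
      · exact h'
      · exact hs g hg ▸ h g hg
  have hd : ∀ τ : Equiv.Perm (Fin (n + 1)),
      HasSign τ j (y (j.succ.succAbove j)) ↔ ¬ HasSign τ j (y (j.castSucc.succAbove j)) := by
    intro τ
    have : τ j.castSucc ≠ τ j.succ := fun h => (Fin.castSucc_lt_succ (i := j)).ne (τ.injective h)
    -- Deleting the right letter of the peak leaves `+` at `j`, deleting the left one leaves `-`.
    rw [Fin.succAbove_of_castSucc_lt _ _ Fin.castSucc_lt_succ, Fin.succAbove_castSucc_self]
    simp only [HasSign, h₁, h₂]
    simp only [true_imp_iff]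
    have e1 : ¬ ((1 : ℤˣ) = -1) := by decide
    have e2 : ¬ ((-1 : ℤˣ) = 1) := by decide
    simp only [e1, e2, false_imp_iff, true_and, and_true, not_lt]
    exact this.le_iff_lt.symm
  unfold alpha
  rw [Finset.filter_congr fun τ _ => split (fun g => j.castSucc.succAbove g) (fun _ _ => rfl) τ,
    Finset.filter_congr fun τ _ => split (fun g => j.succ.succAbove g) hne τ]
  simp only [hd]
  rw [← Finset.filter_filter _ fun τ => HasSign τ j (y (j.castSucc.succAbove j)),
    ← Finset.filter_filter _ fun τ => ¬ HasSign τ j (y (j.castSucc.succAbove j))]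
  exact (Finset.card_filter_add_card_filter_not (s := Finset.univ.filter fun τ :
    Equiv.Perm (Fin (n + 1)) => ∀ g, g ≠ j → HasSign τ g (y (j.castSucc.succAbove g)))
    fun τ => HasSign τ j (y (j.castSucc.succAbove j))).symm

/-- The terms sort the permutations by the position of the largest value: first, last, or at a peak.
-/
theorem alpha_succ {n : ℕ} (y : Fin (n + 1) → ℤˣ) :
    alpha y = (if y 0 = -1 then alpha (fun g : Fin n => y g.succ) else 0) +
      (if y (Fin.last n) = 1 then alpha (fun g : Fin n => y g.castSucc) else 0) +
      ∑ j : Fin n, if y j.castSucc = 1 ∧ y j.succ = -1 then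
        alpha (fun g => y (j.castSucc.succAbove g)) + alpha (fun g => y (j.succ.succAbove g))
        else 0 := by
  conv_lhs => rw [alpha, card_filter_perm_succ, Fin.sum_univ_castSucc, Fin.sum_univ_succ]
  have h0 : ∀ (p : Prop) [Decidable p] (q : Equiv.Perm (Fin (n + 1)) → Prop) [DecidablePred q],
      (Finset.univ.filter fun τ => p ∧ q τ).card = if p then (Finset.univ.filter q).card else 0 := by
    intro p _ q _
    split_ifs with hp <;> simp [hp]
  rw [add_right_comm]
  congr 1
  · congr 1
    · simp only [Fin.castSucc_zero, hasSign_insertPerm_zero, h0]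
      rfl
    · simp only [hasSign_insertPerm_last, h0]
      rfl
  · refine Finset.sum_congr rfl fun j _ => ?_
    simp only [hasSign_insertPerm_middle, h0]
    split_ifs with h
    · exact card_hasSign_ne j h.1 h.2
    · rfl

/-- Adding `alpha_succ` for `y` and `-y` treats peaks and valleys alike, so all sign-changes enter,
and each end letter is deleted for exactly one of the two words. -/
theorem two_mul_alpha {n : ℕ} (y : Fin (n + 1) → ℤˣ) :
    2 * alpha y = alpha (fun g : Fin n => y g.succ) + alpha (fun g : Fin n => y g.castSucc) +
      ∑ j : Fin n, if y j.castSucc = y j.succ then 0 else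
        alpha (fun g => y (j.castSucc.succAbove g)) + alpha (fun g => y (j.succ.succAbove g)) := by
  have h1 := alpha_succ y
  have h2 := alpha_succ (fun i => -y i)
  simp only [alpha_neg, neg_inj, neg_eq_iff_eq_neg (b := (1 : ℤˣ))] at h2
  have hu : ∀ (a : ℤˣ) (c : ℕ), (if a = -1 then c else 0) + (if a = 1 then c else 0) = c := by
    intro a c
    rcases Int.units_eq_one_or a with rfl | rfl <;> simp
  have hs : ∀ (a b : ℤˣ) (c : ℕ), (if a = 1 ∧ b = -1 then c else 0) +
      (if a = -1 ∧ b = 1 then c else 0) = if a = b then 0 else c := by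
    intro a b c
    rcases Int.units_eq_one_or a with rfl | rfl <;> rcases Int.units_eq_one_or b with rfl | rfl <;>
      simp
  have hu0 := hu (y 0) (alpha fun g : Fin n => y g.succ)
  have hu1 := hu (y (Fin.last n)) (alpha fun g : Fin n => y g.castSucc)
  simp only [← hs, Finset.sum_add_distrib]
  linarith

/-- The function `alpha` for words given as lists. -/
def alphaList (u : List ℤˣ) : ℤ := (alpha u.get : ℕ)

theorem alphaList_ofFn {n : ℕ} (y : Fin n → ℤˣ) : alphaList (List.ofFn y) = alpha y := by
  have key : ∀ (m : ℕ) (h : m = n) (y' : Fin m → ℤˣ), (∀ i, y' i = y (Fin.cast h i)) →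
      alpha y' = alpha y := by
    rintro m rfl y' h
    exact congrArg alpha (funext h)
  exact congrArg _ (key _ List.length_ofFn _ fun i => by simp; rfl)

/-- Links the list recursion that path sums follow to the sum over positions in `two_mul_alpha`. -/
theorem changeSum_ofFn {n : ℕ} (φ : List ℤˣ → ℤ) (y : Fin (n + 1) → ℤˣ) :
    changeSum φ (List.ofFn y) = φ (List.ofFn fun g : Fin n => y g.castSucc) +
      ∑ j : Fin n, if y j.castSucc = y j.succ then 0 else
        φ (List.ofFn fun g => y (j.castSucc.succAbove g)) +
        φ (List.ofFn fun g => y (j.succ.succAbove g)) := by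
  induction n generalizing φ with
  | zero => simp [changeSum]
  | succ n ih =>
    have h1 : List.ofFn y = y 0 :: y 1 :: List.ofFn fun g : Fin n => y g.succ.succ := by
      simp [List.ofFn_succ]
    have h2 : List.ofFn (fun g : Fin (n + 1) => y g.succ) =
        y 1 :: List.ofFn fun g : Fin n => y g.succ.succ := by
      simp [List.ofFn_succ]
    rw [h1, changeSum, ← h2, ih, Fin.sum_univ_succ]
    have e : ∀ (f : Fin (n + 1) → ℤˣ), List.ofFn f = f 0 :: List.ofFn fun g : Fin n => f g.succ :=
      fun f => List.ofFn_succ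
    simp only [e (fun g => y (Fin.succAbove _ g)), e (fun g => y g.castSucc),
      e (fun g => y (Fin.succ g)), Fin.castSucc_zero, Fin.succAbove_zero, Fin.succ_succAbove_zero,
      Fin.succ_succAbove_succ, Fin.succ_zero_eq_one, ← Fin.succ_castSucc, Fin.one_succAbove_zero,
      Fin.one_succAbove_succ]
    ring

theorem two_mul_alphaList {u : List ℤˣ} (hu : u ≠ []) :
    alphaList u.tail + changeSum alphaList u = 2 * alphaList u := by
  obtain ⟨a, u, rfl⟩ := List.exists_cons_of_ne_nil hu
  obtain ⟨n, y, hy⟩ : ∃ (n : ℕ) (y : Fin (n + 1) → ℤˣ), a :: u = List.ofFn y :=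
    ⟨u.length, (a :: u).get, (List.ofFn_get _).symm⟩
  have ht : (List.ofFn y).tail = List.ofFn fun g : Fin n => y g.succ := by
    rw [List.ofFn_succ, List.tail_cons]
  rw [hy, changeSum_ofFn, ht]
  simp only [alphaList_ofFn]
  have := two_mul_alpha y
  zify at this
  rw [this]
  ring

/-! ### Dispersed Dyck words as height paths -/

/-- The word `w` describes a height path that starts at `h`, ends at `0`, remains nonnegative, and
has horizontal steps only at height `0`. -/
def IsPathFrom : List SignType → ℕ → Prop
  | [], h => h = 0
  | .zero :: w, h => h = 0 ∧ IsPathFrom w 0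
  | .pos :: w, h => IsPathFrom w (h + 1)
  | .neg :: w, h => 0 < h ∧ IsPathFrom w (h - 1)

/-- The word over `{-, 0, +}` of a list of Dyck steps. -/
def stepSigns (p : List DyckStep) : List SignType :=
  p.map fun s => match s with
    | DyckStep.U => 1
    | DyckStep.D => -1

theorem isPathFrom_stepSigns_append {p : List DyckStep} {w : List SignType} (hw : IsPathFrom w 0)
    (h : ℕ) (hp : h + p.count .U = p.count .D)
    (hpre : ∀ i, (p.take i).count .D ≤ h + (p.take i).count .U) :
    IsPathFrom (stepSigns p ++ w) h := by
  induction p generalizing h with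
  | nil =>
    obtain rfl : h = 0 := by simpa using hp
    exact hw
  | cons s p ih =>
    cases s with
    | U =>
      refine ih (h + 1) ?_ fun i => ?_
      · simp at hp; omega
      · have := hpre (i + 1)
        simp at this; omega
    | D =>
      have h0 := hpre 1
      simp at h0
      refine ⟨h0, ih (h - 1) ?_ fun i => ?_⟩
      · simp at hp; omega
      · have := hpre (i + 1)
        simp at this; omega

theorem IsDispersedDyck.isPathFrom {w : List SignType} (hw : IsDispersedDyck w) :
    IsPathFrom w 0 := by
  obtain ⟨L, rfl, hL⟩ := hw
  induction L with
  | nil => rfl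
  | cons u L ih =>
    have hrest := ih fun v hv => hL v (List.mem_cons_of_mem _ hv)
    rw [List.flatten_cons]
    rcases hL u List.mem_cons_self with ⟨d, rfl⟩ | ⟨k, rfl⟩
    · refine isPathFrom_stepSigns_append hrest 0 ?_ fun i => ?_
      · rw [zero_add, d.count_U_eq_count_D]
      · rw [zero_add]
        exact d.count_D_le_count_U i
    · induction k with
      | zero => exact hrest
      | succ k ihk =>
        refine ⟨rfl, ihk fun v hv => ?_⟩
        rcases List.mem_cons.mp hv with rfl | hv
        · exact Or.inr ⟨k, rfl⟩
        · exact hL v (List.mem_cons_of_mem _ hv)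

theorem IsDispersedDyck.append {v w : List SignType} (hv : IsDispersedDyck v)
    (hw : IsDispersedDyck w) : IsDispersedDyck (v ++ w) := by
  obtain ⟨L, rfl, hL⟩ := hv
  obtain ⟨M, rfl, hM⟩ := hw
  refine ⟨L ++ M, by simp, fun u hu => ?_⟩
  rcases List.mem_append.mp hu with hu | hu
  · exact hL u hu
  · exact hM u hu

theorem isDispersedDyck_stepSigns {p : List DyckStep} (hp : p.count .U = p.count .D)
    (hpre : ∀ i, (p.take i).count .D ≤ (p.take i).count .U) : IsDispersedDyck (stepSigns p) :=
  ⟨[stepSigns p], by simp, fun u hu => Or.inl ⟨⟨p, hp, hpre⟩, List.mem_singleton.mp hu⟩⟩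

theorem isDispersedDyck_zero : IsDispersedDyck [SignType.zero] :=
  ⟨[[SignType.zero]], by simp, fun u hu => Or.inr ⟨1, List.mem_singleton.mp hu⟩⟩

/-- Here `p` is the part before the first `0`; it ends at height 0 because horizontal steps occur
only there. -/
theorem IsPathFrom.exists_stepSigns_append {w : List SignType} {h : ℕ} (hw : IsPathFrom w h) :
    ∃ p v, w = stepSigns p ++ v ∧ h + p.count .U = p.count .D ∧
      (∀ i, (p.take i).count .D ≤ h + (p.take i).count .U) ∧ IsDispersedDyck v := by
  induction w generalizing h with
  | nil =>
    obtain rfl : h = 0 := hw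
    exact ⟨[], [], rfl, by simp, by simp, [], rfl, by simp⟩
  | cons s w ih =>
    cases s with
    | zero =>
      obtain ⟨rfl, hw⟩ := hw
      obtain ⟨p, v, rfl, hp, hpre, hv⟩ := ih hw
      refine ⟨[], _, rfl, by simp, by simp, ?_⟩
      simp only [zero_add] at hp hpre
      exact isDispersedDyck_zero.append ((isDispersedDyck_stepSigns hp hpre).append hv)
    | pos =>
      obtain ⟨p, v, rfl, hp, hpre, hv⟩ := ih (h := h + 1) hw
      refine ⟨.U :: p, v, rfl, ?_, fun i => ?_, hv⟩
      · simp; omega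
      · cases i with
        | zero => simp
        | succ i =>
          have := hpre i
          simp; omega
    | neg =>
      obtain ⟨h0, hw⟩ := hw
      obtain ⟨p, v, rfl, hp, hpre, hv⟩ := ih hw
      refine ⟨.D :: p, v, rfl, ?_, fun i => ?_, hv⟩
      · simp; omega
      · cases i with
        | zero => simp
        | succ i =>
          have := hpre i
          simp; omega

theorem isDispersedDyck_iff_isPathFrom {w : List SignType} :
    IsDispersedDyck w ↔ IsPathFrom w 0 := by
  refine ⟨IsDispersedDyck.isPathFrom, fun hw => ?_⟩
  obtain ⟨p, v, rfl, hp, hpre, hv⟩ := hw.exists_stepSigns_append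
  simp only [zero_add] at hp hpre
  exact (isDispersedDyck_stepSigns hp hpre).append hv

/-- The sum of `F` over the words of length `k` that describe a height path starting at `h`. -/
def heightSum : ℕ → ℕ → (List SignType → ℤ) → ℤ
  | 0, h, F => if h = 0 then F [] else 0
  | k + 1, h, F =>
    (if h = 0 then heightSum k 0 (fun w => F (.zero :: w))
      else heightSum k (h - 1) (fun w => F (.neg :: w))) +
    heightSum k (h + 1) (fun w => F (.pos :: w))

theorem heightSum_const_mul (k h : ℕ) (c : ℤ) (F : List SignType → ℤ) :
    heightSum k h (fun w => c * F w) = c * heightSum k h F := by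
  induction k generalizing h F with
  | zero => unfold heightSum; split_ifs <;> simp
  | succ k ih =>
    simp only [heightSum, ih]
    split_ifs <;> ring

open Classical in
theorem sum_isPathFrom (k h : ℕ) (F : List SignType → ℤ) :
    (∑ f : Fin k → SignType, if IsPathFrom (List.ofFn f) h then F (List.ofFn f) else 0) =
      heightSum k h F := by
  induction k generalizing h F with
  | zero => simp [heightSum, IsPathFrom]
  | succ k ih =>
    rw [← (Fin.consEquiv fun _ => SignType).sum_comp, Fintype.sum_prod_type]
    have huniv : (Finset.univ : Finset SignType) = {.zero, .neg, .pos} := by decide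
    rw [huniv, Finset.sum_insert (by decide), Finset.sum_insert (by decide),
      Finset.sum_singleton]
    have hcons : ∀ (s : SignType) (f : Fin k → SignType),
        List.ofFn (Fin.consEquiv (fun _ => SignType) (s, f)) = s :: List.ofFn f := fun s f => by
      rw [List.ofFn_succ]
      rfl
    simp only [hcons, IsPathFrom, heightSum, ← ih]
    rcases Nat.eq_zero_or_pos h with rfl | hh
    · simp
    · simp only [hh, hh.ne', false_and, if_false, true_and, Finset.sum_const_zero, zero_add]

theorem sum_dispersedDyckWords (k : ℕ) (F : List SignType → ℤ) :
    ∑ w ∈ dispersedDyckWords k, F w = heightSum k 0 F := by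
  classical
  rw [dispersedDyckWords, Finset.sum_filter, Finset.sum_image fun _ _ _ _ h => List.ofFn_injective h,
    ← sum_isPathFrom]
  simp only [isDispersedDyck_iff_isPathFrom]

/-! ### Runs, flips and coefficients when a letter is prepended -/

theorem numRuns_succ {n : ℕ} (y : Fin (n + 1) → ℤˣ) :
    numRuns y = 1 + ∑ g : Fin n, if y g.castSucc ≠ y g.succ then 1 else 0 := by
  have h0 : ∀ k : Fin (n + 1), (k : ℕ) + 1 = ((0 : Fin (n + 1)) : ℕ) → y k ≠ y 0 := by simp
  have hs : ∀ g : Fin n, (∀ k : Fin (n + 1), (k : ℕ) + 1 = (g.succ : ℕ) → y k ≠ y g.succ) ↔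
      y g.castSucc ≠ y g.succ := by
    refine fun g => ⟨fun h => h _ (by simp), fun h k hk => ?_⟩
    obtain rfl : k = g.castSucc := Fin.ext (by simpa using hk)
    exact h
  rw [numRuns, Finset.card_filter, Fin.sum_univ_succ, if_pos h0]
  simp only [hs]

theorem numRuns_cons {n : ℕ} (y : Fin (n + 2) → ℤˣ) :
    numRuns y = numRuns (fun g : Fin (n + 1) => y g.succ) + if y 0 = y 1 then 0 else 1 := by
  rw [numRuns_succ, numRuns_succ, Fin.sum_univ_succ]
  by_cases h : y 0 = y 1
  · simp [h]
  · simp [h]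
    ring

theorem one_le_numRuns {n : ℕ} (y : Fin (n + 1) → ℤˣ) : 1 ≤ numRuns y := by
  rw [numRuns_succ]
  omega

theorem numRuns_le {n : ℕ} (y : Fin n → ℤˣ) : numRuns y ≤ n :=
  (Finset.card_filter_le _ _).trans (Finset.card_fin n).le

theorem signChanges_succ {n : ℕ} (y : Fin (n + 1) → ℤˣ) :
    signChanges y = (Finset.univ.filter fun g : Fin n => y g.castSucc ≠ y g.succ).map
      ⟨fun g => (g.castSucc, g.succ), fun _ _ h => Fin.castSucc_injective _ (Prod.ext_iff.mp h).1⟩ := by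
  ext ⟨a, b⟩
  simp only [signChanges, Finset.mem_filter, Finset.mem_univ, true_and, Finset.mem_map]
  constructor
  · rintro ⟨h1, h2⟩
    have ha : (a : ℕ) < n := by omega
    have e1 : Fin.castSucc ⟨a, ha⟩ = a := rfl
    have e2 : Fin.succ ⟨a, ha⟩ = b := Fin.ext h1
    exact ⟨⟨a, ha⟩, by rwa [e1, e2], Prod.ext e1 e2⟩
  · rintro ⟨g, h, he⟩
    cases he
    exact ⟨by simp, h⟩

theorem runIndex_succ {n : ℕ} (y : Fin (n + 1) → ℤˣ) (i : Fin (n + 1)) :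
    runIndex y i = ∑ g : Fin n,
      if y g.castSucc ≠ y g.succ ∧ g.castSucc < i then 1 else 0 := by
  rw [runIndex, signChanges_succ, Finset.filter_map, Finset.card_map, Finset.filter_filter,
    Finset.card_filter]
  rfl

theorem runIndex_zero {n : ℕ} (y : Fin (n + 1) → ℤˣ) : runIndex y 0 = 0 := by
  simp [runIndex_succ]

theorem runIndex_cons {n : ℕ} (y : Fin (n + 2) → ℤˣ) (i : Fin (n + 1)) :
    runIndex y i.succ =
      runIndex (fun g : Fin (n + 1) => y g.succ) i + if y 0 = y 1 then 0 else 1 := by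
  rw [runIndex_succ, runIndex_succ, Fin.sum_univ_succ]
  simp only [Fin.castSucc_zero, Fin.succ_zero_eq_one, ne_eq, ite_not, ← Fin.succ_castSucc,
    Fin.succ_lt_succ_iff, Fin.succ_pos, and_true]
  ring

theorem flipRuns_zero {n : ℕ} (y : Fin (n + 1) → ℤˣ) (w : List SignType) :
    flipRuns y w 0 = y 0 := by
  simp [flipRuns, runIndex_zero]

theorem flipRuns_succ_of_eq {n : ℕ} {y : Fin (n + 2) → ℤˣ} (h : y 0 = y 1) (w : List SignType)
    (i : Fin (n + 1)) :
    flipRuns y w i.succ = flipRuns (fun g : Fin (n + 1) => y g.succ) w i := by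
  simp [flipRuns, runIndex_cons, h]

theorem flipRuns_succ_of_ne {n : ℕ} {y : Fin (n + 2) → ℤˣ} (h : y 0 ≠ y 1) (s : SignType)
    (w : List SignType) (i : Fin (n + 1)) :
    flipRuns y (s :: w) i.succ =
      (if s = .zero then 1 else -1) * flipRuns (fun g : Fin (n + 1) => y g.succ) w i := by
  cases s <;> simp [flipRuns, runIndex_cons, h, pow_succ]

/-- The factor that a letter of `w` contributes to `coeff`. -/
def letterCoeff (s : SignType) (a b : ℤ) : ℤ :=
  match s with
  | .pos => a
  | .neg => b
  | .zero => 1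

theorem coeff_succ {n : ℕ} (w : List SignType) (y z : Fin (n + 1) → ℤˣ) :
    coeff w y z = ∏ g : Fin n, if y g.castSucc ≠ y g.succ then
      letterCoeff (w.getD (runIndex y g.castSucc) 0) (z g.castSucc) (z g.succ) else 1 := by
  rw [← Finset.prod_filter, coeff, signChanges_succ, Finset.prod_map]
  rfl

theorem coeff_of_eq {n : ℕ} {y : Fin (n + 2) → ℤˣ} (h : y 0 = y 1) (z : Fin (n + 2) → ℤˣ)
    (w : List SignType) :
    coeff w y z = coeff w (fun g : Fin (n + 1) => y g.succ) (fun g : Fin (n + 1) => z g.succ) := by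
  rw [coeff_succ, coeff_succ, Fin.prod_univ_succ]
  simp [h, runIndex_cons]

theorem coeff_of_ne {n : ℕ} {y : Fin (n + 2) → ℤˣ} (h : y 0 ≠ y 1) (z : Fin (n + 2) → ℤˣ)
    (s : SignType) (w : List SignType) :
    coeff (s :: w) y z = letterCoeff s (z 0) (z 1) *
      coeff w (fun g : Fin (n + 1) => y g.succ) (fun g : Fin (n + 1) => z g.succ) := by
  rw [coeff_succ, coeff_succ, Fin.prod_univ_succ]
  simp [h, runIndex_cons, runIndex_zero]

/-! ### The formula `Q` as a path sum -/

/-- For the induction on the first letter the starting height `h` must be arbitrary; its parity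
enters as a global sign `(-1) ^ h` on the flipped word. -/
theorem pathSum_ofFn {n : ℕ} (φ : List ℤˣ → ℤ) (h : ℕ) (y z : Fin (n + 1) → ℤˣ) :
    pathSum (List.ofFn fun g : Fin n => (y g.succ, z g.succ)) φ h (y 0, z 0) =
      if IsProperColoring (List.ofFn fun i => (y i, z i)) then
        2 ^ (n + 1 - numRuns y) * heightSum (numRuns y - 1) h fun w =>
          (-1) ^ (w.count 1) * coeff w y z * φ (List.ofFn fun i => (-1) ^ h * flipRuns y w i)
      else 0 := by
  induction n generalizing φ h with
  | zero =>
    have : numRuns y = 1 := by simp [numRuns_succ]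
    rcases Nat.eq_zero_or_pos h with rfl | hh
    · simp [this, heightSum, pathSum, IsProperColoring, coeff_succ, flipRuns_zero]
    · simp [this, heightSum, pathSum, hh.ne']
  | succ n ih =>
    have hle := numRuns_le fun g : Fin (n + 1) => y g.succ
    have hge := one_le_numRuns fun g : Fin (n + 1) => y g.succ
    have hw : ∀ (k : ℕ) (w : List SignType), (List.ofFn fun i => (-1) ^ k * flipRuns y w i) =
        (-1) ^ k * y 0 :: List.ofFn fun i : Fin (n + 1) => (-1) ^ k * flipRuns y w i.succ := by
      intro k w
      rw [List.ofFn_succ, flipRuns_zero]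
    have hproper : IsProperColoring (List.ofFn fun i => (y i, z i)) ↔
        ((y 0, z 0) ≠ (y 1, z 1) ∧
          IsProperColoring (List.ofFn fun i : Fin (n + 1) => (y i.succ, z i.succ))) := by
      simp only [IsProperColoring, List.ofFn_succ, List.isChain_cons_cons, Fin.succ_zero_eq_one]
    have hih := fun (ψ : List ℤˣ → ℤ) k =>
      ih ψ k (fun g : Fin (n + 1) => y g.succ) (fun g : Fin (n + 1) => z g.succ)
    simp only [Fin.succ_zero_eq_one] at hih
    rw [List.ofFn_succ, pathSum]
    simp only [Fin.succ_zero_eq_one, hih, hw]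
    by_cases hp : IsProperColoring (List.ofFn fun i : Fin (n + 1) => (y i.succ, z i.succ))
    swap
    · rw [if_neg fun H => hp (hproper.mp H).2]
      simp only [hp, if_false]
      simp [step]
    simp only [hp, if_true]
    by_cases hy : y 0 = y 1
    · by_cases hz : z 0 = z 1
      · rw [if_neg fun H => (hproper.mp H).1 (by rw [hy, hz])]
        rcases Int.units_eq_one_or (z 1) with h1 | h1 <;> simp [step, hy, hz, h1]
      · have hr := numRuns_cons y
        rw [if_pos hy, add_zero] at hr
        have hzz : (1 : ℤ) - z 0 * z 1 = 2 := by
          rw [Int.units_ne_iff_eq_neg.mp hz]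
          rcases Int.units_eq_one_or (z 1) with h1 | h1 <;> simp [h1]
        rw [if_pos (hproper.mpr ⟨by simp [hz], hp⟩)]
        simp only [step, if_pos hy, hzz, hr, coeff_of_eq hy, flipRuns_succ_of_eq hy]
        -- The new letter prolongs the first run and yields one more factor 2.
        rw [Nat.sub_add_comm hle, pow_succ]
        ring
    · have hr := numRuns_cons y
      rw [if_neg hy] at hr
      -- A sign-change adds a letter to `w` and leaves the exponent of 2 unchanged.
      have hk : numRuns y - 1 = numRuns (fun g : Fin (n + 1) => y g.succ) - 1 + 1 := by omega
      have he : n + 1 + 1 - numRuns y = n + 1 - numRuns (fun g : Fin (n + 1) => y g.succ) := by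
        omega
      rw [if_pos (hproper.mpr ⟨by simp [hy], hp⟩), hk, he, heightSum]
      simp only [step, if_neg hy, coeff_of_ne hy, flipRuns_succ_of_ne hy, letterCoeff]
      set m := numRuns (fun g : Fin (n + 1) => y g.succ)
      have e0 : ∀ w : List SignType, (SignType.zero :: w).count 1 = w.count 1 := fun w => by
        rw [List.count_cons_of_ne (by decide)]
      have e1 : ∀ w : List SignType, (SignType.neg :: w).count 1 = w.count 1 := fun w => by
        rw [List.count_cons_of_ne (by decide)]
      have e2 : ∀ w : List SignType, (SignType.pos :: w).count 1 = w.count 1 + 1 := fun w =>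
        List.count_cons_self
      have hsign : ∀ (k : ℕ) (a : ℤˣ), (-1) ^ k * (-1 * a) = (-1) ^ (k + 1) * a := fun k a => by
        rw [pow_succ, mul_assoc]
      have hsign' : ∀ (k : ℕ) (a : ℤˣ), (-1) ^ (k + 1) * (-1 * a) = (-1) ^ k * a := fun k a => by
        rw [pow_succ, mul_assoc, neg_one_mul, neg_one_mul, neg_neg]
      have hpos : ∀ k : ℕ, (heightSum (m - 1) (h + 1) fun w =>
          (-1) ^ ((SignType.pos :: w).count 1) *
            (z 0 * coeff w (fun g : Fin (n + 1) => y g.succ) (fun g : Fin (n + 1) => z g.succ)) *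
            φ ((-1) ^ h * y 0 :: List.ofFn fun i : Fin (n + 1) => (-1) ^ h *
              ((if SignType.pos = SignType.zero then 1 else -1) *
                flipRuns (fun g : Fin (n + 1) => y g.succ) w i))) =
          -z 0 * heightSum (m - 1) (h + 1) fun w => (-1) ^ (w.count 1) *
            coeff w (fun g : Fin (n + 1) => y g.succ) (fun g : Fin (n + 1) => z g.succ) *
            φ ((-1) ^ h * y 0 :: List.ofFn fun i : Fin (n + 1) => (-1) ^ (h + 1) *
              flipRuns (fun g : Fin (n + 1) => y g.succ) w i) := by
        intro _
        rw [← heightSum_const_mul]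
        congr 1
        funext w
        simp only [e2, reduceCtorEq, if_false, hsign]
        ring
      rw [hpos 0]
      rcases h with _ | h
      · simp only [if_true, e0, one_mul]
        ring
      · have hneg : (heightSum (m - 1) h fun w =>
            (-1) ^ ((SignType.neg :: w).count 1) *
              (z 1 * coeff w (fun g : Fin (n + 1) => y g.succ)
                (fun g : Fin (n + 1) => z g.succ)) *
              φ ((-1) ^ (h + 1) * y 0 :: List.ofFn fun i : Fin (n + 1) => (-1) ^ (h + 1) *
                ((if SignType.neg = SignType.zero then 1 else -1) *
                  flipRuns (fun g : Fin (n + 1) => y g.succ) w i))) =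
            z 1 * heightSum (m - 1) h fun w => (-1) ^ (w.count 1) *
              coeff w (fun g : Fin (n + 1) => y g.succ) (fun g : Fin (n + 1) => z g.succ) *
              φ ((-1) ^ (h + 1) * y 0 :: List.ofFn fun i : Fin (n + 1) => (-1) ^ h *
                flipRuns (fun g : Fin (n + 1) => y g.succ) w i) := by
          rw [← heightSum_const_mul]
          congr 1
          funext w
          simp only [e1, reduceCtorEq, if_false, hsign']
          ring
        simp only [Nat.add_one_ne_zero, if_false, Nat.add_sub_cancel, hneg]
        ring

theorem Q_eq_wordSum {n : ℕ} (y z : Fin n → ℤˣ) :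
    Q y z = wordSum alphaList (List.ofFn fun i => (y i, z i)) := by
  cases n with
  | zero =>
    -- Without runs, the truncated `numRuns y - 1` is `0`, and only the empty path remains.
    have hr : numRuns y = 0 := Nat.le_zero.mp (numRuns_le y)
    have hs : signChanges y = ∅ := Finset.eq_empty_of_isEmpty _
    have ha : alphaList [] = alpha (flipRuns y []) := by
      rw [← alphaList_ofFn, List.ofFn_zero]
    simp [Q, IsProperColoring, hr, sum_dispersedDyckWords, heightSum, coeff, hs, wordSum, ha]
  | succ n =>
    rw [List.ofFn_succ, wordSum, pathSum_ofFn, Q]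
    simp only [sum_dispersedDyckWords, pow_zero, one_mul, alphaList_ofFn]

/-! ### Comparison of the two recurrences -/

theorem isProperColoring_ofFn_comp {A B : Type*} {n : ℕ} (e : A ≃ B) (x : Fin n → A) :
    IsProperColoring (List.ofFn fun i => e (x i)) ↔ IsProperColoring (List.ofFn x) := by
  have : (List.ofFn fun i => e (x i)) = (List.ofFn x).map e := List.map_ofFn.symm
  rw [this, IsProperColoring, List.isChain_map]
  simp

theorem buildingCount_eq_wordSum (e : Fin 4 ≃ ℤˣ × ℤˣ) {n : ℕ} (x : Fin n → Fin 4) :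
    (buildingCount x : ℤ) = wordSum alphaList (List.ofFn fun i => e (x i)) := by
  induction n with
  | zero =>
    have ha : alphaList [] = alpha (Fin.elim0 : Fin 0 → ℤˣ) := by
      rw [← alphaList_ofFn, List.ofFn_zero]
    simp [buildingCount, wordSum, ha, alpha]
  | succ n ih =>
    rw [buildingCount_succ]
    split_ifs with h
    · rw [← isProperColoring_ofFn_comp e] at h
      have hcongr : wordSum (fun u => alphaList u.tail + changeSum alphaList u)
          (List.ofFn fun i => e (x i)) = 2 * wordSum alphaList (List.ofFn fun i => e (x i)) := by
        rw [List.ofFn_succ, wordSum, wordSum, ← pathSum_const_mul]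
        -- `two_mul_alphaList` fails for the empty word (the sides are 1 and 2), but `φ` is
        -- evaluated only at nonempty words.
        exact pathSum_congr fun u => two_mul_alphaList (List.cons_ne_nil _ _)
      have hsum : 2 * ∑ i ∈ Finset.range (n + 1),
          wordSum alphaList ((List.ofFn fun i => e (x i)).eraseIdx i) =
          wordSum (fun u => alphaList u.tail + changeSum alphaList u)
            (List.ofFn fun i => e (x i)) := by
        rw [List.ofFn_succ] at h ⊢
        simpa using two_mul_sum_wordSum_eraseIdx h alphaList
      rw [hcongr, Finset.sum_range] at hsum
      push_cast
      simp only [ih, ofFn_comp_succAbove fun i => e (x i)]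
      linarith
    · rw [← isProperColoring_ofFn_comp e] at h
      rw [wordSum_eq_zero h, Nat.cast_zero]

end DyckBuildings

/-- For every identification `e` of the four colors with the columns of two signs, and every word
`x` in the four colors with rows `y` and `z`, we have `B(x) = Q(x)`. -/
theorem theorem7p1 (e : Fin 4 ≃ ℤˣ × ℤˣ) (n : ℕ) (x : Fin n → Fin 4) :
    (DyckBuildings.buildingCount x : ℤ) =
      DyckBuildings.Q (fun i => (e (x i)).1) (fun i => (e (x i)).2) := by
  rw [DyckBuildings.Q_eq_wordSum]
  exact DyckBuildings.buildingCount_eq_wordSum e x
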